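/- Let $V$ be a finite set and $k\ge 0$ an integer. Let $(k+1)^V$ be the set of $k$-tuples $S=(S_1,\dots,S_k)$ of pairwise disjoint subsets of $V$, with $S\sqcap T=(S_j\cap T_j)_j$ and $S\sqcup T=\big((S_j\cup T_j)\setminus\bigcup_{i\ne j}(S_i\cup T_i)\big)_j$. Let $f\colon(k+1)^V\to\mathbb R$ be $k$-submodular, i.e. $f(S)+f(T)\ge f(S\sqcap T)+f(S\sqcup T)$ for all $S,T$; monotone, i.e. $f(S)\le f(T)$ whenever $S_j\subseteq T_j$ for all $j$; and with marginal values in $[0,1]$, i.e. adding an element $e\notin\bigcup_l S_l$ to one component of $S$ changes $f(S)$ by an amount in $[0,1]$. Let $$F(\mathbf x)=\sum_{S\in(k+1)^V} f(S)\Big(\prod_{j\in[k]}\prod_{i\in S_j}x_{i,j}\Big)\prod_{i\in V\setminus\bigcup_j S_j}\Big(1-\sum_{j=1}^k x_{i,j}\Big)$$ be its multilinear extension. Let $M$ be the partition matroid on $V\times[k]$ (independent sets: the sets containing at most one pair $(i,j)$ for each $i\in V$), or, more generally, any matroid on a subset of $V\times[k]$ all of whose independent sets are independent in the partition matroid. A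 set $R$ that is independent in $M$ is identified with the tuple $(\{i:(i,j)\in R\})_{j}\in(k+1)^V$. Let $\mathbf x$ be a point of the matroid polytope $P(M)$ (the convex hull of the indicator vectors of the independent sets of $M$), and let $R$ be a random independent set obtained from $\mathbf x$ by randomized swap rounding, that is, as follows. Write $\mathbf x=\sum_{l=1}^m\beta_l\mathbf 1_{B_l}$ with $B_l$ independent, $\beta_l\ge0$, $\sum_l\beta_l=1$. Merge the first two sets $C,B$ of the list, with coefficients $\gamma,\beta$, as follows: while $C\neq B$, choose $A\subseteq C\setminus B$ and $D\subseteq B\setminus C$ with $|A|,|D|\le1$, not both empty, such that $(C\setminus A)\cup D$ and $(B\setminus D)\cup A$ are independent; with probability $\gamma/(\gamma+\beta)$ (read as $0$ if $\gamma=\beta=0$) replace $B$ by $(B\setminus D)\cup A$, and otherwise replace $C$ by $(C\setminus A)\cup D$. (If $C$ and $B$ are bases, $A$ and $D$ are necessarily singletons; an empty $A$ or $D$ plays the role of a dummy element.) When $C=B$, replace the two sets by the single set $C$ with coefficient $\gamma+\beta$, and continue until a single set is left; this is $R$. The representation of $\mathbf x$ is arbitrary, and so are the choices of $A$ and $D$,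 which may depend on the history. Let $\mu_0=F(\mathbf x)$ and $\delta>0$. Then $$\mathbb E[f(R)]\ge\mu_0,$$ and, if $f$ is non-negative (equivalently, $f(\emptyset,\dots,\emptyset)\ge0$), $$\Pr\big[f(R)\le(1-\delta)\mu_0\big]\le e^{-\mu_0\delta^2/8}.$$ -/

import Mathlib

open MeasureTheory
open scoped NNReal

noncomputable section

namespace KSubmodular

variable {V : Type*} [Fintype V] [DecidableEq V] {k : ℕ}

/-- The elements of `(k+1)^V`: the `k`-tuples `S = (S 0, …, S (k-1))` of pairwise disjoint
subsets of `V`. A function on `(k+1)^V` is modelled by a function on all `k`-tuples of subsets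
whose values at tuples that are not pairwise disjoint are never used. -/
def IsDisjointTuple (S : Fin k → Finset V) : Prop :=
  Pairwise fun i j => Disjoint (S i) (S j)

/-- The union `S 0 ∪ … ∪ S (k-1)`. -/
def support (S : Fin k → Finset V) : Finset V :=
  Finset.univ.biUnion S

/-- `S ⊓ T`: componentwise intersection. -/
def meet (S T : Fin k → Finset V) : Fin k → Finset V :=
  fun j => S j ∩ T j

/-- `S ⊔ T`: the `j`-th component is `S j ∪ T j` without all `S i ∪ T i`, `i ≠ j`. -/
def join (S T : Fin k → Finset V) : Fin k → Finset V :=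
  fun j => (S j ∪ T j) \ (Finset.univ.erase j).biUnion fun i => S i ∪ T i

/-- `f` is `k`-submodular. -/
def IsKSubmodular (f : (Fin k → Finset V) → ℝ) : Prop :=
  ∀ S T, IsDisjointTuple S → IsDisjointTuple T → f (meet S T) + f (join S T) ≤ f S + f T

/-- `f` is monotone for the componentwise inclusion order on `(k+1)^V`. -/
def IsMonotone (f : (Fin k → Finset V) → ℝ) : Prop :=
  ∀ S T, IsDisjointTuple S → IsDisjointTuple T → (∀ j, S j ⊆ T j) → f S ≤ f T

/-- The marginal value `Δ_{e,j} f(S)` of adding `e` to the `j`-th component of `S`. -/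
def marginal (f : (Fin k → Finset V) → ℝ) (e : V) (j : Fin k) (S : Fin k → Finset V) : ℝ :=
  f (Function.update S j (insert e (S j))) - f S

/-- All marginal values `Δ_{e,j} f(S)`, `e ∉ S 0 ∪ … ∪ S (k-1)`, lie in `[0,1]`. -/
def HasUnitMarginals (f : (Fin k → Finset V) → ℝ) : Prop :=
  ∀ S, IsDisjointTuple S → ∀ e ∉ support S, ∀ j, marginal f e j S ∈ Set.Icc (0 : ℝ) 1

open scoped Classical in
/-- The multilinear extension of `f`. -/
def multilinearExtension (f : (Fin k → Finset V) → ℝ) (x : V × Fin k → ℝ) : ℝ :=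
  ∑ S : Fin k → Finset V with IsDisjointTuple S,
    f S * (∏ j, ∏ i ∈ S j, x (i, j)) * ∏ i ∈ (support S)ᶜ, (1 - ∑ j, x (i, j))

/-- The tuple `(S 0, …, S (k-1))` encoded by a set `R` of pairs: `S j = {i | (i, j) ∈ R}`. -/
def toTuple (R : Finset (V × Fin k)) : Fin k → Finset V :=
  fun j => {i | (i, j) ∈ R}

/-- The partition matroid on `V × [k]` with the parts `{i} × [k]`: a set of pairs is independent
iff it contains at most one pair from each part. -/
def partitionMatroid (V : Type*) (k : ℕ) : Matroid (V × Fin k) :=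
  (Matroid.freeOn (Set.univ : Set V)).comap Prod.fst

theorem partitionMatroid_indep_iff {V : Type*} {k : ℕ} (I : Set (V × Fin k)) :
    (partitionMatroid V k).Indep I ↔ ∀ i j j', (i, j) ∈ I → (i, j') ∈ I → j = j' := by
  rw [partitionMatroid, Matroid.comap_indep_iff]
  simp only [Matroid.freeOn_indep_iff, Set.subset_univ, true_and]
  constructor
  · intro h i j j' h1 h2
    exact congrArg Prod.snd (h h1 h2 rfl)
  · rintro h ⟨i, j⟩ h1 ⟨i', j'⟩ h2 hii
    obtain rfl : i = i' := hii
    rw [h i j j' h1 h2]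

end KSubmodular

namespace SwapRounding

variable {E : Type*} [DecidableEq E]

/-- The matroid polytope `P(M)`: the convex hull of the indicator vectors of the independent
sets of `M`. -/
def matroidPolytope (M : Matroid E) : Set (E → ℝ) :=
  convexHull ℝ {x | ∃ I : Set E, M.Indep I ∧ x = I.indicator 1}

/-- `Run M L μ`: started from the formal convex combination `∑ β_l 1_{B_l}` of independent sets
of the matroid `M` that is listed in `L = [(β_1, B_1), (β_2, B_2), …]`, the randomized swap
rounding procedure returns a random set of law `μ`.

The first two sets `C`, `B` of the list, with coefficients `γ`, `β`, are merged by exchange steps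
until they coincide; then they are replaced by one set with coefficient `γ + β`, and the
procedure goes on until one set is left. In an exchange step, an element of `C \ B` and an element
of `B \ C` are selected that can be exchanged without leaving the independent sets; with
probability `γ / (γ + β)` the set `B` is changed, and otherwise the set `C` is changed.

`A` and `D` hold the elements selected in `C \ B` and in `B \ C`. If `C` and `B` are bases, then
`A` and `D` are necessarily singletons. If they are arbitrary independent sets, then one of `A`, `D`
may be empty, which is an exchange with a dummy element, as obtained by completing independent sets
to bases by dummy elements. The exchanged elements may be chosen arbitrarily at each step,
depending on the whole history. -/
inductive Run (M : Matroid E) : List (ℝ≥0 × Finset E) → Measure (Finset E) → Prop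
  | output (γ : ℝ≥0) (C : Finset E) : Run M [(γ, C)] (Measure.dirac C)
  | merged (γ β : ℝ≥0) (C : Finset E) (L : List (ℝ≥0 × Finset E)) (μ : Measure (Finset E)) :
      Run M ((γ + β, C) :: L) μ → Run M ((γ, C) :: (β, C) :: L) μ
  | exchange (γ β : ℝ≥0) (C B A D : Finset E) (L : List (ℝ≥0 × Finset E))
      (μ ν : Measure (Finset E)) :
      A ⊆ C \ B → D ⊆ B \ C → A.card ≤ 1 → D.card ≤ 1 → (A ∪ D).Nonempty →
      M.Indep ((C \ A ∪ D : Finset E) : Set E) → M.Indep ((B \ D ∪ A : Finset E) : Set E) →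
      Run M ((γ, C) :: (β, B \ D ∪ A) :: L) μ →
      Run M ((γ, C \ A ∪ D) :: (β, B) :: L) ν →
      Run M ((γ, C) :: (β, B) :: L) ((γ / (γ + β)) • μ + (1 - γ / (γ + β)) • ν)

/-- `μ` is the law of a random set obtained by randomized swap rounding from the point `x`: for
some representation `x = ∑ β_l 1_{B_l}` of `x` as a convex combination of independent sets, `μ` is
the law of the output of the procedure started from this representation. -/
def IsLaw (M : Matroid E) (x : E → ℝ) (μ : Measure (Finset E)) : Prop :=
  ∃ L : List (ℝ≥0 × Finset E),
    (∀ t ∈ L, M.Indep (t.2 : Set E)) ∧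
    (L.map fun t => t.1).sum = 1 ∧
    (∀ e, x e = (L.map fun t => if e ∈ t.2 then (t.1 : ℝ) else 0).sum) ∧
    Run M L μ

end SwapRounding

end

/-! Swap rounding is compared with independent rounding. `F` is the expectation of `f` when each
element of `V` independently receives a colour or none. For any `h` whose mixed second differences
in two distinct elements are non-positive, the extension of `h` is a convex quadratic along every
exchange direction `1_A - 1_D`. An exchange step moves the point along this direction by a random
amount of mean zero, so by Jensen the expected extension does not decrease, and `E h(R)` is at least
its initial value (`Run.multilinearExtension_le`). For `h = f` this bounds the mean. Submodularity
and monotonicity allow also `h = -exp(-δ f)`, so the lower exponential moment of `f(R)` is at most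
the one under independent rounding. There the entropy method applies: `f` is self-bounding, because
the losses from uncolouring single elements add up to at most `f`. Hence `E exp(-δ f) ≤ exp(-(1 -
exp(-δ)) μ₀)` (`prodExp_exp_neg_le`), and Markov's inequality finishes. -/

namespace ProductExpectation

/-! ### Expectations under product weights -/

variable {V α : Type*} [Fintype V] [DecidableEq V] [Fintype α]

/-- The expectation of `h` under the product of the (signed) weights `q i`. -/
def prodExp (q : V → α → ℝ) (h : (V → α) → ℝ) : ℝ :=
  ∑ c, (∏ i, q i (c i)) * h c

/-- The average of `h` over the coordinate `i` with respect to the weights `r`. -/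
def avg (r : α → ℝ) (i : V) (h : (V → α) → ℝ) : (V → α) → ℝ :=
  fun c => ∑ o, r o * h (Function.update c i o)

omit [Fintype α] in
theorem prod_update_weight (q : V → α → ℝ) (i : V) (r : α → ℝ) (c : V → α) :
    ∏ i', Function.update q i r i' (c i') = r (c i) * ∏ i' ∈ Finset.univ.erase i, q i' (c i') := by
  rw [← Finset.mul_prod_erase _ _ (Finset.mem_univ i)]
  congr 1
  · simp
  · refine Finset.prod_congr rfl fun j hj => ?_
    rw [Function.update_of_ne (Finset.ne_of_mem_erase hj)]

omit [Fintype α] in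
theorem prod_weight (q : V → α → ℝ) (i : V) (c : V → α) :
    ∏ i', q i' (c i') = q i (c i) * ∏ i' ∈ Finset.univ.erase i, q i' (c i') :=
  (Finset.mul_prod_erase _ _ (Finset.mem_univ i)).symm

omit [Fintype α] in
theorem prod_erase_update (q : V → α → ℝ) (i : V) (c : V → α) (o : α) :
    ∏ i' ∈ Finset.univ.erase i, q i' (Function.update c i o i') =
      ∏ i' ∈ Finset.univ.erase i, q i' (c i') := by
  refine Finset.prod_congr rfl fun j hj => ?_
  rw [Function.update_of_ne (Finset.ne_of_mem_erase hj)]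

/-- Since `q i` has total mass one, a second independent value at `i` may be added; exchanging it
with `c i` is an involution that matches the two sums. As `r` may be signed, derivatives in the
weights become differences of `h`. -/
theorem prodExp_update (q : V → α → ℝ) (i : V) (hq : ∑ o, q i o = 1) (r : α → ℝ)
    (h : (V → α) → ℝ) :
    prodExp (Function.update q i r) h = prodExp q (avg r i h) := by
  let W : (V → α) → ℝ := fun c => ∏ i' ∈ Finset.univ.erase i, q i' (c i')
  have hW : ∀ c o, W (Function.update c i o) = W c := prod_erase_update q i
  have h1 : prodExp (Function.update q i r) h =
      ∑ p : (V → α) × α, q i p.2 * (r (p.1 i) * W p.1 * h p.1) := by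
    rw [Fintype.sum_prod_type]
    refine Finset.sum_congr rfl fun c _ => ?_
    simp only
    rw [← Finset.sum_mul, hq, one_mul, prod_update_weight]
  have h2 : prodExp q (avg r i h) =
      ∑ p : (V → α) × α, q i (p.1 i) * (r p.2 * W p.1 * h (Function.update p.1 i p.2)) := by
    rw [Fintype.sum_prod_type]
    refine Finset.sum_congr rfl fun c _ => ?_
    rw [prod_weight q i, avg, Finset.mul_sum]
    refine Finset.sum_congr rfl fun o _ => ?_
    ring
  rw [h1, h2]
  refine Finset.sum_nbij' (fun p => (Function.update p.1 i p.2, p.1 i))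
    (fun p => (Function.update p.1 i p.2, p.1 i)) ?_ ?_ ?_ ?_ ?_
  · simp
  · simp
  · simp
  · simp
  · rintro ⟨c, o⟩ -
    simp [hW]

theorem prodExp_avg (q : V → α → ℝ) (i : V) (hq : ∑ o, q i o = 1) (h : (V → α) → ℝ) :
    prodExp q (avg (q i) i h) = prodExp q h := by
  rw [← prodExp_update q i hq, Function.update_eq_self]

theorem prodExp_update_add_mul (q : V → α → ℝ) (i : V) (r s : α → ℝ) (t : ℝ)
    (h : (V → α) → ℝ) :
    prodExp (Function.update q i fun o => r o + t * s o) h =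
      prodExp (Function.update q i r) h + t * prodExp (Function.update q i s) h := by
  simp only [prodExp, prod_update_weight, Finset.mul_sum, ← Finset.sum_add_distrib]
  refine Finset.sum_congr rfl fun c _ => ?_
  ring

theorem prodExp_mono {q : V → α → ℝ} (hq : ∀ i o, 0 ≤ q i o) {g h : (V → α) → ℝ}
    (hgh : ∀ c, g c ≤ h c) : prodExp q g ≤ prodExp q h :=
  Finset.sum_le_sum fun c _ =>
    mul_le_mul_of_nonneg_left (hgh c) (Finset.prod_nonneg fun i _ => hq i _)

theorem prodExp_sub (q : V → α → ℝ) (g h : (V → α) → ℝ) :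
    prodExp q (fun c => g c - h c) = prodExp q g - prodExp q h := by
  simp only [prodExp, mul_sub, Finset.sum_sub_distrib]

theorem prodExp_const_mul (q : V → α → ℝ) (a : ℝ) (h : (V → α) → ℝ) :
    prodExp q (fun c => a * h c) = a * prodExp q h := by
  simp only [prodExp, Finset.mul_sum, mul_left_comm a]

theorem prodExp_neg (q : V → α → ℝ) (h : (V → α) → ℝ) :
    prodExp q (fun c => -h c) = -prodExp q h := by
  simp only [prodExp, mul_neg, Finset.sum_neg_distrib]

theorem prodExp_sum {ι : Type*} (s : Finset ι) (q : V → α → ℝ) (h : ι → (V → α) → ℝ) :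
    prodExp q (fun c => ∑ i ∈ s, h i c) = ∑ i ∈ s, prodExp q (h i) := by
  simp only [prodExp, Finset.mul_sum]
  exact Finset.sum_comm

theorem prodExp_const {q : V → α → ℝ} (hq : ∀ i, ∑ o, q i o = 1) (a : ℝ) :
    prodExp q (fun _ => a) = a := by
  have := Finset.prod_univ_sum (fun _ : V => (Finset.univ : Finset α)) q
  rw [Fintype.piFinset_univ] at this
  rw [prodExp, ← Finset.sum_mul, ← this]
  simp [hq]

/-! ### Tensorization of entropy -/

section Entropy

/-- The relative entropy density `a log (a / b) - a + b`. -/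
noncomputable def entDiv (a b : ℝ) : ℝ := a * Real.log (a / b) - a + b

/-- Variational formula for entropy: the right side is least when `b` is the mean `m`, and the
excess `b - m - m log (b / m)` is non-negative. -/
theorem sum_mul_log_le_sum_entDiv {w a : α → ℝ} {b : ℝ} (hw : ∀ o, 0 ≤ w o) (hw1 : ∑ o, w o = 1)
    (ha : ∀ o, 0 < a o) (hb : 0 < b) :
    ∑ o, w o * (a o * Real.log (a o)) -
      (∑ o, w o * a o) * Real.log (∑ o, w o * a o) ≤ ∑ o, w o * entDiv (a o) b := by
  set m := ∑ o, w o * a o with hm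
  have hmpos : 0 < m := by
    obtain ⟨o, -, ho⟩ : ∃ o ∈ Finset.univ, 0 < w o :=
      Finset.exists_lt_of_sum_lt (by simp [hw1])
    exact Finset.sum_pos' (fun o _ => mul_nonneg (hw o) (ha o).le)
      ⟨o, Finset.mem_univ _, mul_pos ho (ha o)⟩
  have h1 : ∑ o, w o * entDiv (a o) b =
      ∑ o, w o * (a o * Real.log (a o)) - m * Real.log b - m + b := by
    have : ∀ o, w o * entDiv (a o) b = w o * (a o * Real.log (a o)) - (w o * a o) * Real.log b
        - w o * a o + w o * b := fun o => by
      rw [entDiv, Real.log_div (ha o).ne' hb.ne']; ring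
    simp only [this, Finset.sum_add_distrib, Finset.sum_sub_distrib, ← Finset.sum_mul, ← hm, hw1,
      one_mul]
  have h2 : Real.log (b / m) ≤ b / m - 1 := Real.log_le_sub_one_of_pos (by positivity)
  rw [Real.log_div hb.ne' hmpos.ne'] at h2
  have h3 := mul_le_mul_of_nonneg_left h2 hmpos.le
  have h4 : m * (b / m - 1) = b - m := by field_simp
  rw [h1]
  linarith

/-- Joint convexity (Jensen): `key` is the supporting hyperplane of `a log (a / b)` at the means
`(A, B)`. -/
theorem entDiv_sum_le {w a b : α → ℝ} (hw : ∀ o, 0 ≤ w o) (hw1 : ∑ o, w o = 1)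
    (ha : ∀ o, 0 < a o) (hb : ∀ o, 0 < b o) :
    entDiv (∑ o, w o * a o) (∑ o, w o * b o) ≤ ∑ o, w o * entDiv (a o) (b o) := by
  obtain ⟨o, -, ho⟩ : ∃ o ∈ Finset.univ, 0 < w o :=
    Finset.exists_lt_of_sum_lt (by simp [hw1])
  have hpos : ∀ u : α → ℝ, (∀ o, 0 < u o) → 0 < ∑ o, w o * u o := fun u hu =>
    Finset.sum_pos' (fun o _ => mul_nonneg (hw o) (hu o).le)
      ⟨o, Finset.mem_univ _, mul_pos ho (hu o)⟩
  set A := ∑ o, w o * a o with hA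
  set B := ∑ o, w o * b o with hB
  have hApos : 0 < A := hpos a ha
  have hBpos : 0 < B := hpos b hb
  have key : ∀ o, a o * Real.log (A / B) + a o - b o * (A / B) ≤
      a o * Real.log (a o / b o) := fun o => by
    have hao := ha o
    have hbo := hb o
    have h2 : Real.log ((A / B) / (a o / b o)) ≤ (A / B) / (a o / b o) - 1 :=
      Real.log_le_sub_one_of_pos (by positivity)
    rw [Real.log_div (by positivity) (by positivity)] at h2
    have h3 := mul_le_mul_of_nonneg_left h2 hao.le
    have h4 : a o * ((A / B) / (a o / b o) - 1) = b o * (A / B) - a o := by field_simp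
    linarith
  have h5 := Finset.sum_le_sum fun o (_ : o ∈ Finset.univ) =>
    mul_le_mul_of_nonneg_left (key o) (hw o)
  have h6 : ∑ o, w o * (a o * Real.log (A / B) + a o - b o * (A / B)) =
      A * Real.log (A / B) + A - B * (A / B) := by
    have : ∀ o, w o * (a o * Real.log (A / B) + a o - b o * (A / B)) =
      w o * a o * Real.log (A / B) + w o * a o - w o * b o * (A / B) := fun o => by ring
    simp only [this, Finset.sum_add_distrib, Finset.sum_sub_distrib, ← Finset.sum_mul, ← hA, ← hB]
  have h7 : B * (A / B) = A := by field_simp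
  have h8 : ∑ o, w o * entDiv (a o) (b o) =
      ∑ o, w o * (a o * Real.log (a o / b o)) - A + B := by
    have : ∀ o, w o * entDiv (a o) (b o) =
      w o * (a o * Real.log (a o / b o)) - w o * a o + w o * b o := fun o => by
        rw [entDiv]; ring
    simp only [this, Finset.sum_add_distrib, Finset.sum_sub_distrib, ← hA, ← hB]
  rw [h8, entDiv]
  linarith

/-- The successive averages over the coordinates in a list. -/
def listAvg (q : V → α → ℝ) (l : List V) (h : (V → α) → ℝ) : (V → α) → ℝ :=
  l.foldr (fun i u => avg (q i) i u) h

omit [Fintype V] in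
theorem avg_pos {r : α → ℝ} (hr : ∀ o, 0 ≤ r o) (hr1 : ∑ o, r o = 1) (i : V)
    {h : (V → α) → ℝ} (hh : ∀ c, 0 < h c) (c : V → α) : 0 < avg r i h c := by
  obtain ⟨o, -, ho⟩ : ∃ o ∈ Finset.univ, 0 < r o :=
    Finset.exists_lt_of_sum_lt (by simp [hr1])
  exact Finset.sum_pos' (fun o _ => mul_nonneg (hr o) (hh _).le)
    ⟨o, Finset.mem_univ _, mul_pos ho (hh _)⟩

omit [Fintype V] in
theorem listAvg_pos {q : V → α → ℝ} (hq : ∀ i o, 0 ≤ q i o) (hq1 : ∀ i, ∑ o, q i o = 1)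
    (l : List V) {h : (V → α) → ℝ} (hh : ∀ c, 0 < h c) (c : V → α) : 0 < listAvg q l h c := by
  induction l generalizing c with
  | nil => exact hh c
  | cons i l ih => exact avg_pos (hq i) (hq1 i) i ih c

theorem prodExp_listAvg {q : V → α → ℝ} (hq1 : ∀ i, ∑ o, q i o = 1)
    (l : List V) (h : (V → α) → ℝ) : prodExp q (listAvg q l h) = prodExp q h := by
  induction l with
  | nil => rfl
  | cons i l ih => exact (prodExp_avg q i (hq1 i) _).trans ih

omit [Fintype V] in
theorem listAvg_update_of_mem {q : V → α → ℝ} {l : List V} {i : V} (hi : i ∈ l)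
    (h : (V → α) → ℝ) (c : V → α) (o : α) :
    listAvg q l h (Function.update c i o) = listAvg q l h c := by
  induction l generalizing c with
  | nil => simp at hi
  | cons j l ih =>
    change avg _ _ _ _ = avg _ _ _ _
    simp only [avg]
    refine Finset.sum_congr rfl fun o' _ => ?_
    by_cases hij : i = j
    · subst hij; simp
    · rw [Function.update_comm hij, ← listAvg, ih ((List.mem_cons.1 hi).resolve_left hij)]

omit [Fintype V] in
theorem listAvg_update_of_notMem {q : V → α → ℝ} {l : List V} {i : V} (hi : i ∉ l)
    (h : (V → α) → ℝ) (c : V → α) (o : α) :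
    listAvg q l h (Function.update c i o) =
      listAvg q l (fun c => h (Function.update c i o)) c := by
  induction l generalizing c with
  | nil => rfl
  | cons j l ih =>
    rw [List.mem_cons, not_or] at hi
    change avg _ _ _ _ = avg _ _ _ _
    simp only [avg]
    refine Finset.sum_congr rfl fun o' _ => ?_
    rw [Function.update_comm hi.1, ← listAvg, ih hi.2]
    rfl

omit [Fintype V] in
theorem entDiv_listAvg_le {q : V → α → ℝ} (hq : ∀ i o, 0 ≤ q i o) (hq1 : ∀ i, ∑ o, q i o = 1)
    (l : List V) {g h : (V → α) → ℝ} (hg : ∀ c, 0 < g c) (hh : ∀ c, 0 < h c) (c : V → α) :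
    entDiv (listAvg q l g c) (listAvg q l h c) ≤ listAvg q l (fun c => entDiv (g c) (h c)) c := by
  induction l generalizing c with
  | nil => exact le_rfl
  | cons i l ih =>
    refine (entDiv_sum_le (hq i) (hq1 i) (fun o => listAvg_pos hq hq1 l hg _)
      (fun o => listAvg_pos hq hq1 l hh _)).trans ?_
    exact Finset.sum_le_sum fun o _ => mul_le_mul_of_nonneg_left (ih _) (hq i o)

/-- Tensorization of entropy along a list of coordinates. -/
theorem entropy_listAvg_le {q : V → α → ℝ} (hq : ∀ i o, 0 ≤ q i o) (hq1 : ∀ i, ∑ o, q i o = 1)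
    (z : α) {l : List V} (hl : l.Nodup) {g : (V → α) → ℝ} (hg : ∀ c, 0 < g c) :
    prodExp q (fun c => g c * Real.log (g c)) -
      prodExp q (fun c => listAvg q l g c * Real.log (listAvg q l g c)) ≤
    (l.map fun i => prodExp q fun c => entDiv (g c) (g (Function.update c i z))).sum := by
  induction l with
  | nil => simp [listAvg]
  | cons i l ih =>
    rw [List.nodup_cons] at hl
    have h1 := ih hl.2
    set G := listAvg q l g with hG
    have hGpos : ∀ c, 0 < G c := listAvg_pos hq hq1 l hg
    have h2 : prodExp q (fun c => G c * Real.log (G c)) -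
        prodExp q (fun c => avg (q i) i G c * Real.log (avg (q i) i G c)) ≤
        prodExp q fun c => entDiv (g c) (g (Function.update c i z)) := by
      rw [← prodExp_avg q i (hq1 i) (fun c => G c * Real.log (G c)), ← prodExp_sub]
      -- The reference value is `G` with coordinate `i` reset to `z`, which is constant while `i` is
      -- averaged.
      have h3 : ∀ c, avg (q i) i (fun c => G c * Real.log (G c)) c -
          avg (q i) i G c * Real.log (avg (q i) i G c) ≤
          avg (q i) i (fun c => entDiv (G c) (G (Function.update c i z))) c := fun c => by
        refine (sum_mul_log_le_sum_entDiv (hq i) (hq1 i) (fun o => hGpos _)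
          (hGpos (Function.update c i z))).trans_eq ?_
        simp only [avg, Function.update_idem]
      refine (prodExp_mono hq h3).trans ?_
      rw [prodExp_avg q i (hq1 i), ← prodExp_listAvg hq1 l
        (fun c => entDiv (g c) (g (Function.update c i z)))]
      refine prodExp_mono hq fun c => ?_
      -- As `i ∉ l`, resetting `i` commutes with averaging over `l`, so joint convexity passes from
      -- `G` back to `g`.
      rw [hG, listAvg_update_of_notMem hl.1]
      exact entDiv_listAvg_le hq hq1 l hg (fun c => hg _) c
    have h4 : listAvg q (i :: l) g = avg (q i) i G := rfl
    rw [List.map_cons, List.sum_cons, h4]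
    linarith

omit [Fintype α] in
theorem eq_of_forall_update_eq {u : (V → α) → ℝ}
    (hu : ∀ c i o, u (Function.update c i o) = u c) (c d : V → α) : u c = u d := by
  have : ∀ s : Finset V, u (s.piecewise c d) = u d := fun s => by
    induction s using Finset.induction_on with
    | empty => simp
    | insert i s _ ih => rw [Finset.piecewise_insert, hu, ih]
  simpa using this Finset.univ

/-- Tensorization of entropy for a product of probability weights. -/
theorem entropy_le {q : V → α → ℝ} (hq : ∀ i o, 0 ≤ q i o) (hq1 : ∀ i, ∑ o, q i o = 1)
    (z : α) {g : (V → α) → ℝ} (hg : ∀ c, 0 < g c) :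
    prodExp q (fun c => g c * Real.log (g c)) - prodExp q g * Real.log (prodExp q g) ≤
    ∑ i, prodExp q fun c => entDiv (g c) (g (Function.update c i z)) := by
  have h := entropy_listAvg_le hq hq1 z (Finset.nodup_toList Finset.univ) hg
  -- Averaged over every coordinate, `g` is constant, hence equal to its mean.
  have hc : listAvg q Finset.univ.toList g = fun _ => prodExp q g := by
    have h1 := eq_of_forall_update_eq (u := listAvg q Finset.univ.toList g)
      fun c i o => listAvg_update_of_mem (by simp) g c o
    funext c
    have h2 : listAvg q Finset.univ.toList g = fun _ => listAvg q Finset.univ.toList g c :=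
      funext fun d => h1 d c
    rw [← prodExp_listAvg hq1 Finset.univ.toList g]
    conv_rhs => rw [h2]
    rw [prodExp_const hq1]
  rw [Finset.sum_map_toList] at h
  simpa only [hc, prodExp_const hq1] using h

end Entropy

/-! ### Exponential moments of self-bounding functions -/

section SelfBounding

/-- Herbst's argument: the differential inequality makes `L y / (1 - exp (-y))` antitone on `y > 0`,
and its limit at `0` is `L' 0`, a quotient of slopes. -/
theorem le_one_sub_exp_mul_of_deriv {L L' : ℝ → ℝ} (hL : ∀ x, HasDerivAt L (L' x) x)
    (h0 : L 0 = 0) (h : ∀ x, 0 < x → (Real.exp x - 1) * L' x ≤ L x) {x : ℝ} (hx : 0 < x) :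
    L x ≤ (1 - Real.exp (-x)) * L' 0 := by
  have hd : ∀ y : ℝ, HasDerivAt (fun y => 1 - Real.exp (-y)) (Real.exp (-y)) y := fun y => by
    simpa using ((hasDerivAt_neg y).exp).const_sub 1
  have hpos : ∀ y : ℝ, 0 < y → 0 < 1 - Real.exp (-y) := fun y hy => by
    simpa using hy
  have hK : ∀ y : ℝ, 0 < y → HasDerivAt (fun y => L y / (1 - Real.exp (-y)))
      ((L' y * (1 - Real.exp (-y)) - L y * Real.exp (-y)) / (1 - Real.exp (-y)) ^ 2) y :=
    fun y hy => (hL y).div (hd y) (hpos y hy).ne'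
  have hanti : AntitoneOn (fun y => L y / (1 - Real.exp (-y))) (Set.Ioi 0) := by
    refine antitoneOn_of_deriv_nonpos (convex_Ioi 0)
      (fun y hy => (hK y hy).continuousAt.continuousWithinAt) ?_ ?_
    · rw [interior_Ioi]
      exact fun y hy => (hK y hy).differentiableAt.differentiableWithinAt
    · rw [interior_Ioi]
      intro y hy
      rw [(hK y hy).deriv]
      refine div_nonpos_of_nonpos_of_nonneg ?_ (sq_nonneg _)
      have h1 := mul_le_mul_of_nonneg_left (h y hy) (Real.exp_pos (-y)).le
      have h2 : Real.exp (-y) * Real.exp y = 1 := by rw [← Real.exp_add]; simp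
      have h3 : Real.exp (-y) * ((Real.exp y - 1) * L' y) = L' y * (1 - Real.exp (-y)) := by
        linear_combination L' y * h2
      linarith
  have hlim : Filter.Tendsto (fun y => L y / (1 - Real.exp (-y))) (nhdsWithin 0 (Set.Ioi 0))
      (nhds (L' 0)) := by
    have t1 := (hL 0).tendsto_slope_zero_right
    have t2 := (hd 0).tendsto_slope_zero_right
    have t3 := t1.div t2 (by simp)
    simp only [zero_add, h0, sub_zero, neg_zero, Real.exp_zero, sub_self, smul_eq_mul,
      div_one] at t3
    refine t3.congr' ?_
    filter_upwards [self_mem_nhdsWithin] with y hy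
    have hy' : y ≠ 0 := ne_of_gt hy
    simp only [Pi.div_apply]
    rw [mul_div_mul_left _ _ (inv_ne_zero hy')]
  have hle : L x / (1 - Real.exp (-x)) ≤ L' 0 := by
    refine ge_of_tendsto hlim ?_
    filter_upwards [Ioo_mem_nhdsGT hx] with y hy
    exact hanti hy.1 hx hy.2.le
  rw [div_le_iff₀ (hpos x hx)] at hle
  linarith

/-- With `u = a - b` in `[0,1]` the left side is `exp (-(l a)) (exp (l u) - 1 - l u)`, and `exp (l
u)` lies below its chord. The bound is linear in `u`, so the self-bounding property can be summed
into it. -/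
theorem entDiv_exp_le {l a b : ℝ} (h0 : b ≤ a) (h1 : a ≤ b + 1) :
    entDiv (Real.exp (-(l * a))) (Real.exp (-(l * b))) ≤
      Real.exp (-(l * a)) * ((a - b) * (Real.exp l - 1 - l)) := by
  have hconv : Real.exp (l * (a - b)) ≤ 1 + (a - b) * (Real.exp l - 1) := by
    have := convexOn_exp.2 (Set.mem_univ 0) (Set.mem_univ l)
      (by linarith : (0 : ℝ) ≤ 1 - (a - b)) (by linarith : (0 : ℝ) ≤ a - b) (by ring)
    simp only [smul_eq_mul, mul_zero, zero_add, Real.exp_zero] at this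
    rw [mul_comm (a - b) l] at this
    linarith
  have hb : Real.exp (-(l * b)) = Real.exp (-(l * a)) * Real.exp (l * (a - b)) := by
    rw [← Real.exp_add]; ring_nf
  have := mul_le_mul_of_nonneg_left hconv (Real.exp_pos (-(l * a))).le
  rw [entDiv, ← Real.exp_sub, Real.log_exp, hb]
  linarith

/-- The lower exponential moments of a self-bounding function of independent variables. -/
theorem prodExp_exp_neg_le {q : V → α → ℝ} (hq : ∀ i o, 0 ≤ q i o) (hq1 : ∀ i, ∑ o, q i o = 1)
    (z : α) {f : (V → α) → ℝ} (hmono : ∀ c i, f (Function.update c i z) ≤ f c)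
    (hunit : ∀ c i, f c ≤ f (Function.update c i z) + 1)
    (hself : ∀ c, ∑ i, (f c - f (Function.update c i z)) ≤ f c) {l : ℝ} (hl : 0 < l) :
    prodExp q (fun c => Real.exp (-(l * f c))) ≤
      Real.exp (-((1 - Real.exp (-l)) * prodExp q f)) := by
  let H : ℝ → ℝ := fun s => prodExp q fun c => Real.exp (-(s * f c))
  let N : ℝ → ℝ := fun s => prodExp q fun c => f c * Real.exp (-(s * f c))
  have hHpos : ∀ s, 0 < H s := fun s => by
    obtain ⟨m, hm, hm'⟩ : ∃ m : ℝ, 0 < m ∧ ∀ c, m ≤ Real.exp (-(s * f c)) := by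
      have : Nonempty α := ⟨z⟩
      have : Nonempty (V → α) := ⟨fun _ => z⟩
      obtain ⟨c₀, hc₀⟩ := Finite.exists_min fun c => Real.exp (-(s * f c))
      exact ⟨_, Real.exp_pos _, hc₀⟩
    refine hm.trans_le ?_
    rw [← prodExp_const hq1 m]
    exact prodExp_mono hq hm'
  have hH : ∀ s, HasDerivAt H (-N s) s := fun s => by
    have : -N s = ∑ c, (∏ i, q i (c i)) * (Real.exp (-(s * f c)) * -f c) := by
      simp only [N, prodExp, ← Finset.sum_neg_distrib]
      refine Finset.sum_congr rfl fun c _ => by ring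
    rw [this]
    refine HasDerivAt.fun_sum fun c _ => HasDerivAt.const_mul _ (HasDerivAt.exp ?_)
    simpa using ((hasDerivAt_id s).mul_const (f c)).fun_neg
  have hL : ∀ s, HasDerivAt (fun s => Real.log (H s)) (-N s / H s) s := fun s =>
    (hH s).log (hHpos s).ne'
  have hH0 : H 0 = 1 := by simp only [H, zero_mul, neg_zero, Real.exp_zero, prodExp_const hq1]
  have hN0 : N 0 = prodExp q f := by simp [N]
  -- Entropy of `exp (-s f)` is `-s N - H log H`; tensorization bounds it by `(exp s - 1 - s) N`.
  -- Dividing by `H` gives the differential inequality for `log H`.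
  have hent : ∀ s, 0 < s → (Real.exp s - 1) * (-N s / H s) ≤ Real.log (H s) := fun s hs => by
    have h1 := entropy_le hq hq1 z (g := fun c => Real.exp (-(s * f c))) fun c => Real.exp_pos _
    have h2 : ∑ i, prodExp q (fun c => entDiv (Real.exp (-(s * f c)))
        (Real.exp (-(s * f (Function.update c i z))))) ≤ (Real.exp s - 1 - s) * N s := by
      rw [← prodExp_sum, ← prodExp_const_mul]
      refine prodExp_mono hq fun c => ?_
      refine (Finset.sum_le_sum fun i _ => entDiv_exp_le (hmono c i) (hunit c i)).trans ?_
      rw [← Finset.mul_sum, ← Finset.sum_mul]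
      have h3 : 0 ≤ Real.exp s - 1 - s := by linarith [Real.add_one_le_exp s]
      have h4 := mul_le_mul_of_nonneg_left (hself c) (mul_nonneg (Real.exp_pos (-(s * f c))).le h3)
      linarith
    have h5 : prodExp q (fun c => Real.exp (-(s * f c)) * Real.log (Real.exp (-(s * f c)))) =
        -s * N s := by
      rw [← prodExp_const_mul]
      congr 1
      funext c
      rw [Real.log_exp]
      ring
    rw [h5] at h1
    have h6 : (Real.exp s - 1) * (-N s / H s) = -((Real.exp s - 1) * N s) / H s := by ring
    rw [h6, div_le_iff₀ (hHpos s)]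
    change _ - H s * Real.log (H s) ≤ _ at h1
    linarith
  have hfin := le_one_sub_exp_mul_of_deriv hL (by rw [hH0, Real.log_one]) hent hl
  rw [hH0, hN0, div_one] at hfin
  rw [← Real.log_le_iff_le_exp (hHpos l)]
  linarith

end SelfBounding

end ProductExpectation

/-! ### Tuples as partial colourings, and the multilinear extension as an expectation -/

namespace KSubmodular

open ProductExpectation

variable {V : Type*} [Fintype V] [DecidableEq V] {k : ℕ}

/-- The tuple of colour classes of a partial colouring of `V` with `k` colours. -/
def colorTuple (c : V → Option (Fin k)) : Fin k → Finset V :=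
  fun j => {i | c i = some j}

omit [DecidableEq V] in
theorem mem_colorTuple {c : V → Option (Fin k)} {i : V} {j : Fin k} :
    i ∈ colorTuple c j ↔ c i = some j := by
  simp [colorTuple]

omit [DecidableEq V] in
theorem isDisjointTuple_colorTuple (c : V → Option (Fin k)) : IsDisjointTuple (colorTuple c) := by
  intro j j' hne
  rw [Finset.disjoint_left]
  intro i hi hi'
  rw [mem_colorTuple] at hi hi'
  exact hne (Option.some_injective _ (hi.symm.trans hi'))

theorem mem_support_colorTuple {c : V → Option (Fin k)} {i : V} :
    i ∈ support (colorTuple c) ↔ c i ≠ none := by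
  simp only [support, Finset.mem_biUnion, Finset.mem_univ, true_and, mem_colorTuple]
  exact Option.ne_none_iff_exists'.symm

omit [DecidableEq V] in
theorem colorTuple_injective : Function.Injective (colorTuple (V := V) (k := k)) := by
  intro c d h
  funext i
  refine Option.ext fun j => ?_
  rw [← mem_colorTuple, ← mem_colorTuple, h]

theorem exists_colorTuple_eq {S : Fin k → Finset V} (hS : IsDisjointTuple S) :
    ∃ c, colorTuple c = S := by
  classical
  refine ⟨fun i => if h : ∃ j, i ∈ S j then some h.choose else none, ?_⟩
  funext j
  ext i
  rw [mem_colorTuple]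
  constructor
  · intro h
    split_ifs at h with h'
    rw [← Option.some_injective _ h]
    exact h'.choose_spec
  · intro h
    have h' : ∃ j, i ∈ S j := ⟨j, h⟩
    rw [dif_pos h']
    congr 1
    by_contra hne
    exact Finset.disjoint_left.1 (hS hne) h'.choose_spec h

/-- The weights of the colours at each element of `V` that belong to the point `x`. -/
def colorWeight (x : V × Fin k → ℝ) (i : V) : Option (Fin k) → ℝ
  | none => 1 - ∑ j, x (i, j)
  | some j => x (i, j)

omit [Fintype V] [DecidableEq V] in
theorem sum_colorWeight (x : V × Fin k → ℝ) (i : V) : ∑ o, colorWeight x i o = 1 := by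
  simp [Fintype.sum_option, colorWeight]

theorem prod_colorWeight (x : V × Fin k → ℝ) (c : V → Option (Fin k)) :
    ∏ i, colorWeight x i (c i) =
      (∏ j, ∏ i ∈ colorTuple c j, x (i, j)) *
        ∏ i ∈ (support (colorTuple c))ᶜ, (1 - ∑ j, x (i, j)) := by
  rw [← Finset.prod_fiberwise Finset.univ c, Fintype.prod_option, mul_comm]
  congr 1
  · refine Finset.prod_congr rfl fun j _ => Finset.prod_congr rfl fun i hi => ?_
    rw [mem_colorTuple.1 hi, colorWeight]
  · refine Finset.prod_congr ?_ fun i hi => ?_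
    · ext i
      rw [Finset.mem_compl, mem_support_colorTuple]
      simp
    · rw [Finset.mem_compl, mem_support_colorTuple, not_not] at hi
      rw [hi, colorWeight]

theorem multilinearExtension_eq_prodExp (f : (Fin k → Finset V) → ℝ) (x : V × Fin k → ℝ) :
    multilinearExtension f x = prodExp (colorWeight x) fun c => f (colorTuple c) := by
  rw [multilinearExtension, prodExp]
  symm
  refine Finset.sum_bij (fun c _ => colorTuple c) ?_ ?_ ?_ ?_
  · intro c _
    simpa using isDisjointTuple_colorTuple c
  · intro c _ d _ h
    exact colorTuple_injective h
  · intro S hS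
    obtain ⟨c, hc⟩ := exists_colorTuple_eq (S := S) (by simpa using hS)
    exact ⟨c, Finset.mem_univ _, hc⟩
  · intro c _
    rw [prod_colorWeight]
    ring

/-! ### Consequences of `k`-submodularity -/

variable {f : (Fin k → Finset V) → ℝ}

/-- The submodular inequality for two partial colourings without a conflict. -/
theorem IsKSubmodular.colorTuple_le (hf : IsKSubmodular f) {s t m u : V → Option (Fin k)}
    (h : ∀ i, (s i = t i ∧ m i = s i ∧ u i = s i) ∨ (s i = none ∧ m i = none ∧ u i = t i) ∨
      (t i = none ∧ m i = none ∧ u i = s i)) :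
    f (colorTuple m) + f (colorTuple u) ≤ f (colorTuple s) + f (colorTuple t) := by
  have key := hf _ _ (isDisjointTuple_colorTuple s) (isDisjointTuple_colorTuple t)
  have h1 : meet (colorTuple s) (colorTuple t) = colorTuple m := by
    funext j
    ext i
    simp only [meet, Finset.mem_inter, mem_colorTuple]
    rcases h i with ⟨h1, h2, h3⟩ | ⟨h1, h2, h3⟩ | ⟨h1, h2, h3⟩ <;> simp [h1, h2]
  have h2 : join (colorTuple s) (colorTuple t) = colorTuple u := by
    funext j
    ext i
    simp only [join, Finset.mem_sdiff, Finset.mem_union, Finset.mem_biUnion, Finset.mem_erase,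
      Finset.mem_univ, and_true, mem_colorTuple]
    rcases h i with ⟨h1, h2, h3⟩ | ⟨h1, h2, h3⟩ | ⟨h1, h2, h3⟩ <;> simp only [h1, h3] <;> grind
  rwa [h1, h2] at key

theorem IsMonotone.colorTuple_update_none_le (hf : IsMonotone f) (c : V → Option (Fin k)) (i : V) :
    f (colorTuple (Function.update c i none)) ≤ f (colorTuple c) := by
  refine hf _ _ (isDisjointTuple_colorTuple _) (isDisjointTuple_colorTuple _) fun j i' h => ?_
  rw [mem_colorTuple] at h ⊢
  by_cases hi : i' = i
  · subst hi; simp at h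
  · rwa [Function.update_of_ne hi] at h

theorem HasUnitMarginals.colorTuple_le (hf : HasUnitMarginals f) (c : V → Option (Fin k)) (i : V) :
    f (colorTuple c) ≤ f (colorTuple (Function.update c i none)) + 1 := by
  rcases hc : c i with _ | j
  · rw [← hc, Function.update_eq_self]
    linarith
  · have h1 := (hf (colorTuple (Function.update c i none)) (isDisjointTuple_colorTuple _) i
      (by rw [mem_support_colorTuple]; simp) j).2
    have h2 : Function.update (colorTuple (Function.update c i none)) j
        (insert i (colorTuple (Function.update c i none) j)) = colorTuple c := by
      funext j'
      ext i'
      by_cases hj : j' = j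
      · subst hj
        rw [Function.update_self, Finset.mem_insert, mem_colorTuple, mem_colorTuple]
        by_cases hi : i' = i
        · subst hi; simp [hc]
        · simp [hi]
      · rw [Function.update_of_ne hj, mem_colorTuple, mem_colorTuple]
        by_cases hi : i' = i
        · subst hi; simp [hc, Ne.symm hj]
        · simp [hi]
    rw [marginal, h2] at h1
    linarith

/-- Diminishing returns: uncolouring `i` in `c` loses at most what it loses after the set `s` has
been uncoloured. The latter losses telescope. With `f ∅ ≥ 0` this is the self-bounding property. -/
theorem sum_colorTuple_sub_le (hsub : IsKSubmodular f) (c : V → Option (Fin k)) :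
    ∑ i, (f (colorTuple c) - f (colorTuple (Function.update c i none))) ≤
      f (colorTuple c) - f fun _ => ∅ := by
  have key : ∀ s : Finset V,
      ∑ i ∈ s, (f (colorTuple c) - f (colorTuple (Function.update c i none))) ≤
        f (colorTuple c) - f (colorTuple fun i => if i ∈ s then none else c i) := fun s => by
    induction s using Finset.induction_on with
    | empty => simp
    | insert i s hi ih =>
      rw [Finset.sum_insert hi]
      have := hsub.colorTuple_le (s := fun i => if i ∈ s then none else c i)
        (t := Function.update c i none) (m := fun i' => if i' ∈ insert i s then none else c i')
        (u := c) fun i' => by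
          by_cases h1 : i' = i
          · subst h1
            by_cases h2 : c i' = none <;> simp [hi, h2]
          · by_cases h2 : i' ∈ s <;> simp [h1, h2]
      linarith
  have h0 : (colorTuple fun _ : V => (none : Option (Fin k))) = fun _ => ∅ := by
    funext j
    simp [colorTuple]
  simpa [h0] using key Finset.univ

/-- The lower exponential moments of a monotone `k`-submodular function under independent
rounding. -/
theorem multilinearExtension_exp_neg_le (hsub : IsKSubmodular f) (hmono : IsMonotone f)
    (hmarg : HasUnitMarginals f) (h0 : 0 ≤ f fun _ => ∅) {x : V × Fin k → ℝ}
    (hx : ∀ i o, 0 ≤ colorWeight x i o) {l : ℝ} (hl : 0 < l) :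
    multilinearExtension (fun S => Real.exp (-(l * f S))) x ≤
      Real.exp (-((1 - Real.exp (-l)) * multilinearExtension f x)) := by
  rw [multilinearExtension_eq_prodExp, multilinearExtension_eq_prodExp]
  exact prodExp_exp_neg_le hx (sum_colorWeight x) none
    (fun c i => hmono.colorTuple_update_none_le c i) (fun c i => hmarg.colorTuple_le c i)
    (fun c => by linarith [sum_colorTuple_sub_le hsub c]) hl

/-- The mixed second differences in two distinct elements of `V` are non-positive. -/
def HasNonposMixedDiff (h : (Fin k → Finset V) → ℝ) : Prop :=
  ∀ (c : V → Option (Fin k)) (i i' : V) (j j' : Fin k), i ≠ i' →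
    h (colorTuple (Function.update (Function.update c i (some j)) i' (some j'))) +
      h (colorTuple (Function.update (Function.update c i none) i' none)) ≤
    h (colorTuple (Function.update (Function.update c i (some j)) i' none)) +
      h (colorTuple (Function.update (Function.update c i none) i' (some j')))

theorem IsKSubmodular.hasNonposMixedDiff (hf : IsKSubmodular f) : HasNonposMixedDiff f := by
  intro c i i' j j' hne
  rw [add_comm (f _)]
  refine hf.colorTuple_le fun v => ?_
  by_cases h1 : v = i'
  · subst h1; simp
  · by_cases h2 : v = i
    · subst h2; simp [h1]
    · simp [h1, h2]

/-- Put `u = exp (-l (a10 - a00))` and `v = exp (-l (a01 - a00))`. Submodularity gives `exp (-l a11)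
≥ exp (-l a00) u v`, monotonicity gives `u, v ≤ 1`, and `1 + u v - u - v = (1 - u) (1 - v) ≥ 0`. -/
theorem hasNonposMixedDiff_neg_exp_neg (hsub : IsKSubmodular f) (hmono : IsMonotone f) {l : ℝ}
    (hl : 0 ≤ l) : HasNonposMixedDiff fun S => -Real.exp (-(l * f S)) := by
  intro c i i' j j' hne
  have h1 := hsub.hasNonposMixedDiff c i i' j j' hne
  set a11 := f (colorTuple (Function.update (Function.update c i (some j)) i' (some j')))
  have h2 := hmono.colorTuple_update_none_le
    (Function.update (Function.update c i (some j)) i' none) i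
  have h3 := hmono.colorTuple_update_none_le
    (Function.update (Function.update c i none) i' (some j')) i'
  rw [Function.update_comm hne.symm, Function.update_idem] at h2
  rw [Function.update_idem] at h3
  set a00 := f (colorTuple (Function.update (Function.update c i none) i' none))
  set a10 := f (colorTuple (Function.update (Function.update c i (some j)) i' none))
  set a01 := f (colorTuple (Function.update (Function.update c i none) i' (some j')))
  have e1 : Real.exp (-(l * (a10 + a01 - a00))) ≤ Real.exp (-(l * a11)) := by
    refine Real.exp_le_exp.2 (neg_le_neg (mul_le_mul_of_nonneg_left ?_ hl))
    linarith
  have e2 : Real.exp (-(l * (a10 + a01 - a00))) =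
      Real.exp (-(l * a00)) * Real.exp (-(l * (a10 - a00))) * Real.exp (-(l * (a01 - a00))) := by
    rw [← Real.exp_add, ← Real.exp_add]; ring_nf
  have e3 : Real.exp (-(l * a10)) = Real.exp (-(l * a00)) * Real.exp (-(l * (a10 - a00))) := by
    rw [← Real.exp_add]; ring_nf
  have e4 : Real.exp (-(l * a01)) = Real.exp (-(l * a00)) * Real.exp (-(l * (a01 - a00))) := by
    rw [← Real.exp_add]; ring_nf
  have e5 : Real.exp (-(l * (a10 - a00))) ≤ 1 :=
    Real.exp_le_one_iff.2 (neg_nonpos.2 (mul_nonneg hl (by linarith)))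
  have e6 : Real.exp (-(l * (a01 - a00))) ≤ 1 :=
    Real.exp_le_one_iff.2 (neg_nonpos.2 (mul_nonneg hl (by linarith)))
  have e7 := mul_nonneg (Real.exp_pos (-(l * a00))).le
    (mul_nonneg (sub_nonneg.2 e5) (sub_nonneg.2 e6))
  simp only
  rw [e3, e4]
  rw [e2] at e1
  linarith

/-! ### The multilinear extension along exchange directions -/

/-- The direction in which the colour weights at `i` change if `x (i, j)` grows. -/
def colorDir (j : Fin k) : Option (Fin k) → ℝ
  | none => -1
  | some j' => if j' = j then 1 else 0

omit [Fintype V] in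
theorem colorWeight_add_single (x : V × Fin k → ℝ) (a : V × Fin k) (t : ℝ) :
    colorWeight (fun e => x e + t * if e = a then 1 else 0) =
      Function.update (colorWeight x) a.1 fun o => colorWeight x a.1 o + t * colorDir a.2 o := by
  obtain ⟨i, j⟩ := a
  funext i' o
  by_cases hi : i' = i
  · subst hi
    rw [Function.update_self]
    rcases o with _ | j'
    · simp only [colorWeight, colorDir, Prod.mk.injEq, true_and, Finset.sum_add_distrib,
        ← Finset.mul_sum, Finset.sum_ite_eq', Finset.mem_univ, if_true]
      ring
    · simp [colorWeight, colorDir]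
  · rw [Function.update_of_ne hi]
    rcases o with _ | j' <;> simp [colorWeight, hi]

omit [Fintype V] in
theorem avg_colorDir (j : Fin k) (i : V) (h : (V → Option (Fin k)) → ℝ)
    (c : V → Option (Fin k)) :
    avg (colorDir j) i h c =
      h (Function.update c i (some j)) - h (Function.update c i none) := by
  simp [avg, Fintype.sum_option, colorDir]
  ring

/-- Along the line in direction `1_a - 1_d`, the multilinear extension is a convex quadratic. -/
theorem multilinearExtension_add_sub {h : (Fin k → Finset V) → ℝ} (hh : HasNonposMixedDiff h)
    {x : V × Fin k → ℝ} (hx : ∀ i o, 0 ≤ colorWeight x i o) (a d : V × Fin k) :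
    ∃ c₁ c₂ : ℝ, 0 ≤ c₂ ∧ ∀ t : ℝ,
      multilinearExtension h
        (fun e => x e + t * ((if e = a then 1 else 0) - if e = d then 1 else 0)) =
      multilinearExtension h x + t * c₁ + t ^ 2 * c₂ := by
  set H : (V → Option (Fin k)) → ℝ := fun c => h (colorTuple c) with hH
  set q := colorWeight x with hq
  have hx' : ∀ t : ℝ, colorWeight
      (fun e => x e + t * ((if e = a then 1 else 0) - if e = d then 1 else 0)) =
      colorWeight (fun e => (x e + t * if e = a then 1 else 0) + (-t) * if e = d then 1 else 0) :=
    fun t => by congr 1; funext e; ring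
  simp only [multilinearExtension_eq_prodExp, hx', colorWeight_add_single]
  obtain ⟨i, j⟩ := a
  obtain ⟨i', j'⟩ := d
  simp only
  -- Two pairs over the same element change a single factor of the product weight, so the extension
  -- is affine there.
  by_cases hne : i = i'
  · subst hne
    refine ⟨prodExp (Function.update q i (colorDir j)) H -
      prodExp (Function.update q i (colorDir j')) H, 0, le_rfl, fun t => ?_⟩
    rw [Function.update_self, Function.update_idem, prodExp_update_add_mul, prodExp_update_add_mul,
      Function.update_eq_self]
    ring
  -- The directions have opposite signs, so the coefficient of `t ^ 2` is minus the expected mixed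
  -- difference.
  · refine ⟨prodExp (Function.update q i (colorDir j)) H -
      prodExp (Function.update q i' (colorDir j')) H,
      -prodExp (Function.update (Function.update q i (colorDir j)) i' (colorDir j')) H, ?_,
      fun t => ?_⟩
    · rw [Function.update_comm hne, prodExp_update _ _
        (by rw [Function.update_of_ne hne, hq, sum_colorWeight]),
        prodExp_update _ _ (by rw [hq, sum_colorWeight]), ← prodExp_neg]
      have h0 := prodExp_mono (q := q) (g := fun _ => 0) (h := fun c =>
        -avg (colorDir j') i' (avg (colorDir j) i H) c) hx fun c => ?_
      · rwa [prodExp_const (fun i => by rw [hq, sum_colorWeight])] at h0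
      · simp only [avg_colorDir, hH]
        have := hh c i i' j j' hne
        simp only [Function.update_comm (Ne.symm hne)]
        linarith
    · rw [Function.update_of_ne (Ne.symm hne), prodExp_update_add_mul, Function.update_comm hne,
        Function.update_eq_self, prodExp_update_add_mul, Function.update_eq_self,
        Function.update_comm hne, prodExp_update_add_mul, Function.update_comm (Ne.symm hne),
        Function.update_eq_self, Function.update_comm (Ne.symm hne)]
      ring

theorem multilinearExtension_add_single (h : (Fin k → Finset V) → ℝ) (x : V × Fin k → ℝ)
    (a : V × Fin k) :
    ∃ c₁ : ℝ, ∀ t : ℝ,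
      multilinearExtension h (fun e => x e + t * if e = a then 1 else 0) =
      multilinearExtension h x + t * c₁ := by
  refine ⟨prodExp (Function.update (colorWeight x) a.1 (colorDir a.2)) fun c => h (colorTuple c),
    fun t => ?_⟩
  rw [multilinearExtension_eq_prodExp, multilinearExtension_eq_prodExp, colorWeight_add_single,
    prodExp_update_add_mul, Function.update_eq_self]

/-- Along the line of an exchange step, the multilinear extension is a convex quadratic. -/
theorem multilinearExtension_exchange {h : (Fin k → Finset V) → ℝ} (hh : HasNonposMixedDiff h)
    {x : V × Fin k → ℝ} (hx : ∀ i o, 0 ≤ colorWeight x i o) {A D : Finset (V × Fin k)}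
    (hA : A.card ≤ 1) (hD : D.card ≤ 1) :
    ∃ c₁ c₂ : ℝ, 0 ≤ c₂ ∧ ∀ t : ℝ,
      multilinearExtension h
        (fun e => x e + t * ((if e ∈ A then 1 else 0) - if e ∈ D then 1 else 0)) =
      multilinearExtension h x + t * c₁ + t ^ 2 * c₂ := by
  have hcase : ∀ T : Finset (V × Fin k), T.card ≤ 1 → T = ∅ ∨ ∃ a, T = {a} := fun T hT => by
    rcases Nat.le_one_iff_eq_zero_or_eq_one.1 hT with h | h
    · exact Or.inl (Finset.card_eq_zero.1 h)
    · exact Or.inr (Finset.card_eq_one.1 h)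
  rcases hcase A hA with rfl | ⟨a, rfl⟩ <;> rcases hcase D hD with rfl | ⟨d, rfl⟩
  · exact ⟨0, 0, le_rfl, fun t => by simp⟩
  · obtain ⟨c, hc⟩ := multilinearExtension_add_single h x d
    refine ⟨-c, 0, le_rfl, fun t => ?_⟩
    have := hc (-t)
    simp only [Finset.notMem_empty, if_false, Finset.mem_singleton, zero_sub, mul_neg]
    simp only [neg_mul] at this
    rw [this]
    ring
  · obtain ⟨c, hc⟩ := multilinearExtension_add_single h x a
    refine ⟨c, 0, le_rfl, fun t => ?_⟩
    simp only [Finset.notMem_empty, if_false, Finset.mem_singleton, sub_zero, hc]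
    ring
  · simpa only [Finset.mem_singleton] using multilinearExtension_add_sub hh hx a d

end KSubmodular

/-! ### Analysis of swap rounding -/

namespace SwapRounding

open KSubmodular ProductExpectation

section

variable {E : Type*} [DecidableEq E]

/-- The point `∑ β_l 1_{B_l}` that is represented by the list of the pairs `(β_l, B_l)`. -/
def listPoint (L : List (ℝ≥0 × Finset E)) (e : E) : ℝ :=
  (L.map fun t => if e ∈ t.2 then (t.1 : ℝ) else 0).sum

theorem listPoint_cons (t : ℝ≥0 × Finset E) (L : List (ℝ≥0 × Finset E)) (e : E) :
    listPoint (t :: L) e = (if e ∈ t.2 then (t.1 : ℝ) else 0) + listPoint L e := rfl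

theorem Run.isProbabilityMeasure {M : Matroid E} {L : List (ℝ≥0 × Finset E)}
    {μ : Measure (Finset E)} (h : Run M L μ) : IsProbabilityMeasure μ := by
  induction h with
  | output γ C => infer_instance
  | merged γ β C L μ _ ih => exact ih
  | exchange γ β C B A D L μ ν _ _ _ _ _ _ _ _ _ ihμ ihν =>
    have hle : γ / (γ + β) ≤ 1 := div_le_one_of_le₀ le_self_add zero_le
    constructor
    rw [Measure.add_apply, Measure.smul_apply, Measure.smul_apply, measure_univ, measure_univ,
      ENNReal.smul_def, ENNReal.smul_def, smul_eq_mul, smul_eq_mul, mul_one, mul_one,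
      ← ENNReal.coe_add, add_tsub_cancel_of_le hle, ENNReal.coe_one]

end

variable {V : Type*} [DecidableEq V] {k : ℕ} {M : Matroid (V × Fin k)}

theorem listPoint_nonneg (L : List (ℝ≥0 × Finset (V × Fin k))) (e : V × Fin k) :
    0 ≤ listPoint L e := by
  refine List.sum_nonneg fun y hy => ?_
  obtain ⟨t, -, rfl⟩ := List.mem_map.1 hy
  split_ifs
  · exact t.1.2
  · exact le_rfl

/-- An independent set has at most one pair over `i`, so each listed set contributes at most its
coefficient. Hence the colour weights of the point are probabilities. -/
theorem sum_listPoint_le (hM : ∀ I, M.Indep I → (partitionMatroid V k).Indep I)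
    {L : List (ℝ≥0 × Finset (V × Fin k))} (hL : ∀ t ∈ L, M.Indep (t.2 : Set (V × Fin k)))
    (i : V) : ∑ j, listPoint L (i, j) ≤ ((L.map fun t => t.1).sum : ℝ≥0) := by
  induction L with
  | nil => simp [listPoint]
  | cons t L ih =>
    have h1 := ih fun t ht => hL t (List.mem_cons_of_mem _ ht)
    have h2 : ∀ j j', (i, j) ∈ t.2 → (i, j') ∈ t.2 → j = j' :=
      (partitionMatroid_indep_iff _).1 (hM _ (hL t List.mem_cons_self)) i
    have h3 : ∑ j, (if (i, j) ∈ t.2 then (t.1 : ℝ) else 0) ≤ t.1 := by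
      by_cases hj : ∃ j, (i, j) ∈ t.2
      · obtain ⟨j, hj⟩ := hj
        rw [Finset.sum_eq_single_of_mem j (Finset.mem_univ j)
          (fun j' _ hne => if_neg fun hj' => hne (h2 j' j hj' hj)), if_pos hj]
      · rw [Finset.sum_eq_zero fun j _ => if_neg fun h => hj ⟨j, h⟩]
        exact t.1.2
    simp only [listPoint_cons, Finset.sum_add_distrib, List.map_cons, List.sum_cons,
      NNReal.coe_add]
    exact add_le_add h3 h1

theorem colorWeight_listPoint_nonneg (hM : ∀ I, M.Indep I → (partitionMatroid V k).Indep I)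
    {L : List (ℝ≥0 × Finset (V × Fin k))} (hL : ∀ t ∈ L, M.Indep (t.2 : Set (V × Fin k)))
    (hsum : (L.map fun t => t.1).sum = 1) (i : V) (o : Option (Fin k)) :
    0 ≤ colorWeight (listPoint L) i o := by
  rcases o with _ | j
  · have := sum_listPoint_le hM hL i
    rw [hsum, NNReal.coe_one] at this
    exact sub_nonneg.2 this
  · exact listPoint_nonneg L (i, j)

variable [Fintype V]

/-- At an indicator vector the weights at each `i` are a point mass, so a single colouring survives.
-/
theorem multilinearExtension_indicator (h : (Fin k → Finset V) → ℝ) {C : Finset (V × Fin k)}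
    (hC : (partitionMatroid V k).Indep (C : Set (V × Fin k))) :
    multilinearExtension h (fun e => if e ∈ C then 1 else 0) = h (toTuple C) := by
  have hC' := (partitionMatroid_indep_iff _).1 hC
  have hdisj : IsDisjointTuple (toTuple C) := fun j j' hne => by
    refine Finset.disjoint_left.2 fun i hi hi' => ?_
    simp only [toTuple, Finset.mem_filter, Finset.mem_univ, true_and] at hi hi'
    exact hne (hC' i j j' hi hi')
  obtain ⟨c, hc⟩ := exists_colorTuple_eq hdisj
  have hmem : ∀ i j, (i, j) ∈ C ↔ c i = some j := fun i j => by
    rw [← mem_colorTuple, hc]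
    simp [toTuple]
  have hw : ∀ i o, colorWeight (fun e => if e ∈ C then (1 : ℝ) else 0) i o =
      if o = c i then 1 else 0 := fun i o => by
    rcases o with _ | j
    · simp only [colorWeight, hmem]
      rcases c i with _ | j <;> simp
    · simp only [colorWeight, hmem, eq_comm]
  rw [multilinearExtension_eq_prodExp, prodExp, Finset.sum_eq_single c]
  · simp [hw, hc]
  · intro d _ hd
    obtain ⟨i, hi⟩ := Function.ne_iff.1 hd
    rw [Finset.prod_eq_zero (Finset.mem_univ i) (by rw [hw, if_neg hi]), zero_mul]
  · simp

/-- Randomized swap rounding does not decrease the expectation of a function with non-positive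
mixed differences below its multilinear extension. -/
theorem Run.multilinearExtension_le (hM : ∀ I, M.Indep I → (partitionMatroid V k).Indep I)
    {h : (Fin k → Finset V) → ℝ} (hh : HasNonposMixedDiff h)
    {L : List (ℝ≥0 × Finset (V × Fin k))} {μ : Measure (Finset (V × Fin k))} (hrun : Run M L μ)
    (hL : ∀ t ∈ L, M.Indep (t.2 : Set (V × Fin k))) (hsum : (L.map fun t => t.1).sum = 1) :
    multilinearExtension h (listPoint L) ≤ ∫ S, h (toTuple S) ∂μ := by
  induction hrun with
  | output γ C =>
    obtain rfl : γ = 1 := by simpa using hsum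
    rw [integral_dirac, ← multilinearExtension_indicator h (hM _ (hL _ List.mem_cons_self))]
    refine le_of_eq (congrArg _ ?_)
    funext e
    simp [listPoint]
  | merged γ β C L μ _ ih =>
    have h1 : listPoint ((γ, C) :: (β, C) :: L) = listPoint ((γ + β, C) :: L) := by
      funext e
      simp only [listPoint_cons]
      split_ifs
      · push_cast; ring
      · ring
    rw [h1]
    refine ih (fun t ht => ?_) ?_
    · rcases List.mem_cons.1 ht with rfl | ht
      · exact hL (γ, C) List.mem_cons_self
      · exact hL t (List.mem_cons_of_mem _ (List.mem_cons_of_mem _ ht))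
    · simpa [add_assoc] using hsum
  | exchange γ β C B A D L μ ν hAC hDB hA hD _ hiC hiB hμ hν ihμ ihν =>
    have := hμ.isProbabilityMeasure
    have := hν.isProbabilityMeasure
    have hLt : ∀ t ∈ L, M.Indep (t.2 : Set (V × Fin k)) := fun t ht =>
      hL t (List.mem_cons_of_mem _ (List.mem_cons_of_mem _ ht))
    have hCi := hL (γ, C) List.mem_cons_self
    have hBi := hL (β, B) (List.mem_cons_of_mem _ List.mem_cons_self)
    -- Both outcomes lie on one line: changing `B` is `t = β`, changing `C` is `t = -γ`.
    obtain ⟨c₁, c₂, hc₂, hc⟩ := multilinearExtension_exchange hh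
      (colorWeight_listPoint_nonneg hM hL hsum) hA hD
    have hA' : ∀ e ∈ A, e ∈ C ∧ e ∉ B := fun e he => Finset.mem_sdiff.1 (hAC he)
    have hD' : ∀ e ∈ D, e ∈ B ∧ e ∉ C := fun e he => Finset.mem_sdiff.1 (hDB he)
    have e1 : listPoint ((γ, C) :: (β, B \ D ∪ A) :: L) = fun e =>
        listPoint ((γ, C) :: (β, B) :: L) e +
          (β : ℝ) * ((if e ∈ A then 1 else 0) - if e ∈ D then 1 else 0) := by
      funext e
      have hAe := hA' e
      have hDe := hD' e
      simp only [listPoint_cons, Finset.mem_union, Finset.mem_sdiff]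
      by_cases h1 : e ∈ A <;> by_cases h2 : e ∈ D <;> by_cases h3 : e ∈ B <;> simp_all
      ring
    have e2 : listPoint ((γ, C \ A ∪ D) :: (β, B) :: L) = fun e =>
        listPoint ((γ, C) :: (β, B) :: L) e +
          (-γ : ℝ) * ((if e ∈ A then 1 else 0) - if e ∈ D then 1 else 0) := by
      funext e
      have hAe := hA' e
      have hDe := hD' e
      simp only [listPoint_cons, Finset.mem_union, Finset.mem_sdiff]
      by_cases h1 : e ∈ A <;> by_cases h2 : e ∈ D <;> by_cases h3 : e ∈ C <;> simp_all
      ring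
    have i1 := ihμ (List.forall_mem_cons.2 ⟨hCi, List.forall_mem_cons.2 ⟨hiB, hLt⟩⟩)
      (by simpa using hsum)
    have i2 := ihν (List.forall_mem_cons.2 ⟨hiC, List.forall_mem_cons.2 ⟨hBi, hLt⟩⟩)
      (by simpa using hsum)
    rw [e1, hc] at i1
    rw [e2, hc] at i2
    have hle : γ / (γ + β) ≤ 1 := div_le_one_of_le₀ le_self_add zero_le
    rw [integral_add_measure Integrable.of_finite Integrable.of_finite, integral_smul_nnreal_measure,
      integral_smul_nnreal_measure, NNReal.smul_def, NNReal.smul_def, NNReal.coe_sub hle,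
      smul_eq_mul, smul_eq_mul, NNReal.coe_one]
    set w : ℝ := ((γ / (γ + β) : ℝ≥0) : ℝ) with hw
    have hw0 : 0 ≤ w := NNReal.coe_nonneg _
    have hw1 : w ≤ 1 := by rw [hw]; exact_mod_cast hle
    -- The mean displacement is zero. If `γ + β = 0`, both displacements vanish, whatever the value
    -- of `0 / 0`.
    have hbal : w * β = (1 - w) * γ := by
      rcases eq_or_ne (γ + β) 0 with h0 | h0
      · have hγ : γ = 0 := (add_eq_zero.1 h0).1
        have hβ : β = 0 := (add_eq_zero.1 h0).2
        simp [hγ, hβ]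
      · have h0' : (γ : ℝ) + β ≠ 0 := by exact_mod_cast h0
        rw [hw]
        push_cast
        field_simp
        ring
    have j1 := mul_le_mul_of_nonneg_left i1 hw0
    have j2 := mul_le_mul_of_nonneg_left i2 (sub_nonneg.2 hw1)
    have j3 : 0 ≤ (w * (β : ℝ) ^ 2 + (1 - w) * (γ : ℝ) ^ 2) * c₂ :=
      mul_nonneg (add_nonneg (mul_nonneg hw0 (sq_nonneg _))
        (mul_nonneg (sub_nonneg.2 hw1) (sq_nonneg _))) hc₂
    -- The linear term cancels by `hbal`; the second moment times `c₂` remains and is non-negative.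
    linear_combination j1 + j2 + j3 - c₁ * hbal

end SwapRounding

theorem mainTheorem6 {V : Type*} [Fintype V] [DecidableEq V] {k : ℕ}
    (f : (Fin k → Finset V) → ℝ)
    (hsub : KSubmodular.IsKSubmodular f) (hmono : KSubmodular.IsMonotone f)
    (hmarg : KSubmodular.HasUnitMarginals f)
    (M : Matroid (V × Fin k))
    (hM : ∀ I, M.Indep I → (KSubmodular.partitionMatroid V k).Indep I)
    (x : V × Fin k → ℝ) (hx : x ∈ SwapRounding.matroidPolytope M)
    {Ω : Type*} [MeasurableSpace Ω] (P : Measure Ω) [IsProbabilityMeasure P]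
    (R : Ω → Finset (V × Fin k)) (hR : Measurable R)
    (hround : SwapRounding.IsLaw M x (P.map R))
    (δ : ℝ) (hδ : 0 < δ) :
    KSubmodular.multilinearExtension f x ≤ ∫ ω, f (KSubmodular.toTuple (R ω)) ∂P ∧
    (0 ≤ f (fun _ => ∅) →
      P.real {ω | f (KSubmodular.toTuple (R ω)) ≤
          (1 - δ) * KSubmodular.multilinearExtension f x} ≤
        Real.exp (-(KSubmodular.multilinearExtension f x * δ ^ 2 / 8))) := by
  obtain ⟨L, hL, hsum, hxL, hrun⟩ := hround
  obtain rfl : x = SwapRounding.listPoint L := funext hxL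
  have hw := SwapRounding.colorWeight_listPoint_nonneg hM hL hsum
  have hmap : ∀ h : (Fin k → Finset V) → ℝ, ∫ S, h (KSubmodular.toTuple S) ∂(P.map R) =
      ∫ ω, h (KSubmodular.toTuple (R ω)) ∂P := fun h =>
    integral_map hR.aemeasurable (Measurable.of_discrete).aestronglyMeasurable
  refine ⟨?_, fun h0 => ?_⟩
  · rw [← hmap]
    exact hrun.multilinearExtension_le hM hsub.hasNonposMixedDiff hL hsum
  set m := KSubmodular.multilinearExtension f (SwapRounding.listPoint L) with hm
  have hm0 : 0 ≤ m := by
    rw [hm, KSubmodular.multilinearExtension_eq_prodExp,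
      ← ProductExpectation.prodExp_const (KSubmodular.sum_colorWeight (SwapRounding.listPoint L)) 0]
    refine ProductExpectation.prodExp_mono hw fun c => h0.trans ?_
    exact hmono _ _ (fun _ _ _ => Finset.disjoint_empty_left _)
      (KSubmodular.isDisjointTuple_colorTuple c) fun j => Finset.empty_subset _
  have hindep := KSubmodular.multilinearExtension_exp_neg_le hsub hmono hmarg h0 hw hδ
  have hswap := hrun.multilinearExtension_le hM
    (KSubmodular.hasNonposMixedDiff_neg_exp_neg hsub hmono hδ.le) hL hsum
  rw [hmap fun S => -Real.exp (-(δ * f S)), integral_neg,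
    KSubmodular.multilinearExtension_eq_prodExp, ProductExpectation.prodExp_neg,
    neg_le_neg_iff] at hswap
  rw [KSubmodular.multilinearExtension_eq_prodExp] at hindep
  have hint : Integrable (fun ω => Real.exp (-δ * f (KSubmodular.toTuple (R ω)))) P := by
    have : Integrable (fun S => Real.exp (-δ * f (KSubmodular.toTuple S))) (P.map R) := by
      have := Measure.isProbabilityMeasure_map (μ := P) hR.aemeasurable
      exact Integrable.of_finite
    exact this.comp_measurable hR
  -- The parameter `-δ` replaces the optimal `log (1 - δ)`, which makes sense only for `δ < 1`.
  have hmarkov := ProbabilityTheory.measure_le_le_exp_mul_mgf (μ := P)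
    (X := fun ω => f (KSubmodular.toTuple (R ω))) ((1 - δ) * m) (neg_nonpos.2 hδ.le) hint
  have hmgf : ProbabilityTheory.mgf (fun ω => f (KSubmodular.toTuple (R ω))) P (-δ) ≤
      Real.exp (-((1 - Real.exp (-δ)) * m)) := by
    simp only [ProbabilityTheory.mgf, neg_mul]
    exact hswap.trans hindep
  refine hmarkov.trans ((mul_le_mul_of_nonneg_left hmgf (Real.exp_pos _).le).trans ?_)
  rw [← Real.exp_add, Real.exp_le_exp]
  -- This follows from `(1 - δ + δ²/2) (1 + δ + δ²/2) = 1 + δ⁴/4 ≥ 1`. The exponent is then at most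
  -- `-m δ²/2`, stronger than `-m δ²/8`.
  have hexp : Real.exp (-δ) ≤ 1 - δ + δ ^ 2 / 2 := by
    have h1 := Real.quadratic_le_exp_of_nonneg hδ.le
    have h2 : Real.exp (-δ) * Real.exp δ = 1 := by rw [← Real.exp_add]; simp
    have h3 : 0 ≤ 1 - δ + δ ^ 2 / 2 := by nlinarith [sq_nonneg (δ - 1)]
    have h4 : 1 ≤ (1 - δ + δ ^ 2 / 2) * Real.exp δ := by
      refine le_trans ?_ (mul_le_mul_of_nonneg_left h1 h3)
      nlinarith [sq_nonneg (δ ^ 2)]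
    exact le_of_mul_le_mul_right (h2.trans_le h4) (Real.exp_pos δ)
  have h5 := mul_le_mul_of_nonneg_right hexp hm0
  have h6 := mul_nonneg hm0 (sq_nonneg δ)
  linarith
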